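/- Let $d\ge 1$ and let $\Omega\subset\mathbb{R}^d$ be a bounded domain with smooth boundary $\Gamma:=\partial\Omega$, where $\Gamma$ carries its $(d-1)$-dimensional surface measure. Let $\mathbf{H}:=L^2(\Omega)\times L^2(\Gamma)$ (real-valued functions), a Hilbert space with norm $|(u,u_\Gamma)|_{\mathbf H}=\bigl(|u|_{L^2(\Omega)}^2+|u_\Gamma|_{L^2(\Gamma)}^2\bigr)^{1/2}$, and let $$\mathbf{V}:=\bigl\{(u,u_\Gamma)\in H^1(\Omega)\times H^1(\Gamma)\,:\ u_{|_\Gamma}=u_\Gamma\ \text{ a.e. on }\Gamma\bigr\},$$ where $u_{|_\Gamma}$ denotes the trace of $u$ on $\Gamma$. Then $\mathbf{V}$ is dense in $\mathbf{H}$. -/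

import Mathlib

open MeasureTheory Filter Topology
open scoped ContDiff

noncomputable section

namespace DynBdry

/-- `ℝᵈ` with the Euclidean norm. -/
abbrev E (d : ℕ) : Type := EuclideanSpace ℝ (Fin d)

/-- A bounded domain (nonempty, open, connected) of `ℝᵈ` with smooth boundary: near each boundary
point, after a linear isometry splitting `ℝᵈ` as `ℝᵈ⁻¹ × ℝ`, the set `Ω` is the region strictly
above the graph of a `C^∞` function. -/
structure IsBoundedSmoothDomain {d : ℕ} (Ω : Set (E d)) : Prop where
  isOpen : IsOpen Ω
  isConnected : IsConnected Ω
  isBounded : Bornology.IsBounded Ω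
  smooth_boundary : ∀ x ∈ frontier Ω, ∃ r > (0 : ℝ),
    ∃ e : E d ≃ₗᵢ[ℝ] WithLp 2 (E (d - 1) × ℝ), ∃ γ : E (d - 1) → ℝ, ContDiff ℝ ∞ γ ∧
      ∀ y ∈ Metric.ball x r, y ∈ Ω ↔ γ (e y).fst < (e y).snd

/-- Lebesgue measure on `Ω`. -/
def bulkMeasure {d : ℕ} (Ω : Set (E d)) : Measure (E d) := volume.restrict Ω

/-- The surface measure on `Γ = ∂Ω`: the `(d-1)`-dimensional Hausdorff measure on `Γ`, with the
normalization which agrees with Lebesgue measure on `ℝᵈ⁻¹`. -/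
def surfaceMeasure {d : ℕ} (Ω : Set (E d)) : Measure (E d) :=
  (Measure.euclideanHausdorffMeasure (d - 1)).restrict (frontier Ω)

/-- `∂ᵢ φ` (classical). -/
def partialDeriv {k : ℕ} (i : Fin k) (φ : E k → ℝ) (x : E k) : ℝ :=
  fderiv ℝ φ x (EuclideanSpace.single i 1)

/-- `g` is the weak `i`-th partial derivative of `f` on the open set `U`; used only for `f`, `g`
locally square integrable on `U`. -/
def HasWeakPartialDeriv {k : ℕ} (U : Set (E k)) (i : Fin k) (f g : E k → ℝ) : Prop :=
  ∀ η : E k → ℝ, ContDiff ℝ ∞ η → HasCompactSupport η → tsupport η ⊆ U →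
    ∫ x in U, f x * partialDeriv i η x = - ∫ x in U, g x * η x

/-- `f` belongs to `H¹(U)`. -/
def MemH1 {k : ℕ} (U : Set (E k)) (f : E k → ℝ) : Prop :=
  MemLp f 2 (volume.restrict U) ∧
    ∀ i, ∃ g : E k → ℝ, MemLp g 2 (volume.restrict U) ∧ HasWeakPartialDeriv U i f g

/-- `f` belongs to `L²_loc(U)`. -/
def MemL2Loc {k : ℕ} (U : Set (E k)) (f : E k → ℝ) : Prop :=
  ∀ K : Set (E k), IsCompact K → K ⊆ U → MemLp f 2 (volume.restrict K)

/-- `f` belongs to `H¹_loc(U)`. -/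
def MemH1Loc {k : ℕ} (U : Set (E k)) (f : E k → ℝ) : Prop :=
  MemL2Loc U f ∧ ∀ i, ∃ g : E k → ℝ, MemL2Loc U g ∧ HasWeakPartialDeriv U i f g

/-- `ψ : W → S` is a smooth local parametrization of the hypersurface `S ⊆ ℝᵈ`: `W ⊆ ℝᵈ⁻¹` is open
and `ψ` is a smooth immersion which maps `W` homeomorphically onto a relatively open subset
of `S`. -/
structure IsLocalParam {d : ℕ} (S : Set (E d)) (W : Set (E (d - 1)))
    (ψ : E (d - 1) → E d) : Prop where
  isOpen : IsOpen W
  contDiffOn : ContDiffOn ℝ ∞ ψ W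
  immersion : ∀ y ∈ W, Function.Injective (fderiv ℝ ψ y)
  isOpenEmbedding : ∃ h : Set.MapsTo ψ W S, IsOpenEmbedding (h.restrict ψ W S)

/-- `g` belongs to `H¹(Γ)`, `Γ = ∂Ω`: it is in `L²(Γ)` and all its expressions in local
coordinates of `Γ` have locally square integrable weak first derivatives. As `Γ` is compact,
finitely many compact coordinate patches cover it, so the local condition is the global one. -/
def MemH1Boundary {d : ℕ} (Ω : Set (E d)) (g : E d → ℝ) : Prop :=
  MemLp g 2 (surfaceMeasure Ω) ∧
    ∀ (W : Set (E (d - 1))) (ψ : E (d - 1) → E d), IsLocalParam (frontier Ω) W ψ →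
      MemH1Loc W (g ∘ ψ)

/-- `g ∈ L²(Γ)` is the trace on `Γ = ∂Ω` of `u ∈ H¹(Ω)`. The trace operator is the continuous
extension to `H¹(Ω)`, with values in `L²(Γ)`, of the restriction to `Γ` of functions smooth up to
the boundary: `g` is the trace of `u` if some functions `φ n`, smooth on `ℝᵈ`, converge to `u` in
`H¹(Ω)` while their restrictions to `Γ` converge to `g` in `L²(Γ)`. -/
def IsTrace {d : ℕ} (Ω : Set (E d)) (u g : E d → ℝ) : Prop :=
  ∃ Du : Fin d → E d → ℝ,
    (∀ i, MemLp (Du i) 2 (bulkMeasure Ω) ∧ HasWeakPartialDeriv Ω i u (Du i)) ∧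
    ∃ φ : ℕ → E d → ℝ, (∀ n, ContDiff ℝ ∞ (φ n)) ∧
      Tendsto (fun n => eLpNorm (fun x => φ n x - u x) 2 (bulkMeasure Ω)) atTop (𝓝 0) ∧
      (∀ i, Tendsto (fun n => eLpNorm (fun x => partialDeriv i (φ n) x - Du i x) 2
        (bulkMeasure Ω)) atTop (𝓝 0)) ∧
      Tendsto (fun n => eLpNorm (fun x => φ n x - g x) 2 (surfaceMeasure Ω)) atTop (𝓝 0)

/-- The Hilbert space `𝐇 = L²(Ω) × L²(Γ)`, with norm `(|u|² + |u_Γ|²)^{1/2}`. -/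
abbrev HSpace {d : ℕ} (Ω : Set (E d)) : Type :=
  WithLp 2 (Lp ℝ 2 (bulkMeasure Ω) × Lp ℝ 2 (surfaceMeasure Ω))

/-- `𝐕 = {(u, u_Γ) ∈ H¹(Ω) × H¹(Γ) : u|_Γ = u_Γ a.e. on Γ}`, as a subset of `𝐇`. -/
def VSpace {d : ℕ} (Ω : Set (E d)) : Set (HSpace Ω) :=
  {p | MemH1 Ω p.fst ∧ MemH1Boundary Ω p.snd ∧ IsTrace Ω p.fst p.snd}

end DynBdry

end

/-!
The surface measure is concentrated on `∂Ω`, which is disjoint from the open set `Ω`, so it is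
singular with respect to Lebesgue measure on `Ω`. Hence a pair in `L²(Ω) × L²(Γ)` glues to a single
function in `L²` of the sum of the two measures. If the surface measure is locally finite, smooth
compactly supported functions are dense in the latter space, and every such `φ` yields the pair
`(φ, φ|_Γ) ∈ 𝐕`. Local finiteness for smooth boundaries holds because a boundary patch is a
Lipschitz image of a piece of `ℝᵈ⁻¹`.
-/

namespace DynBdry

open scoped ENNReal NNReal

section Density

variable {V F : Type*} [NormedAddCommGroup V] [NormedSpace ℝ V] [FiniteDimensional ℝ V]
  [MeasurableSpace V] [BorelSpace V] [NormedAddCommGroup F] [NormedSpace ℝ F]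
  {p : ℝ≥0∞} [Fact (1 ≤ p)]

theorem dense_ae_eq_contDiff_restrict_compl (hp : p ≠ ⊤) (μ : Measure V)
    [IsFiniteMeasureOnCompacts μ] {A : Set V} (hA : MeasurableSet A) :
    Dense {q : Lp F p (μ.restrict A) × Lp F p (μ.restrict Aᶜ) | ∃ φ : V → F, ContDiff ℝ ∞ φ ∧
      HasCompactSupport φ ∧ q.1 =ᵐ[μ.restrict A] φ ∧ q.2 =ᵐ[μ.restrict Aᶜ] φ} := by
  classical
  let restrictBoth : Lp F p μ →L[ℝ] Lp F p (μ.restrict A) × Lp F p (μ.restrict Aᶜ) :=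
    (LpToLpRestrictCLM V F ℝ μ p A).prod (LpToLpRestrictCLM V F ℝ μ p Aᶜ)
  have surjective : Function.Surjective restrictBoth := by
    rintro ⟨f, g⟩
    have hfg : MemLp (A.piecewise f g) p μ := MemLp.piecewise hA (Lp.memLp f) (Lp.memLp g)
    have hfg_left : A.piecewise f g =ᵐ[μ.restrict A] f := piecewise_ae_eq_restrict hA
    have hfg_right : A.piecewise f g =ᵐ[μ.restrict Aᶜ] g := piecewise_ae_eq_restrict_compl hA
    have hfg_coe (s : Set V) : hfg.toLp _ =ᵐ[μ.restrict s] A.piecewise f g :=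
      ae_restrict_of_ae hfg.coeFn_toLp
    exact ⟨hfg.toLp _, Prod.ext
      (Lp.ext ((LpToLpRestrictCLM_coeFn ℝ A _).trans ((hfg_coe A).trans hfg_left)))
      (Lp.ext ((LpToLpRestrictCLM_coeFn ℝ Aᶜ _).trans ((hfg_coe Aᶜ).trans hfg_right)))⟩
  refine (surjective.denseRange.dense_image restrictBoth.continuous
    (Lp.dense_hasCompactSupport_contDiff hp)).mono ?_
  rintro _ ⟨f, ⟨φ, hfφ, hc, hφ⟩, rfl⟩
  exact ⟨φ, hφ, hc, (LpToLpRestrictCLM_coeFn ℝ A f).trans (ae_restrict_of_ae hfφ),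
    (LpToLpRestrictCLM_coeFn ℝ Aᶜ f).trans (ae_restrict_of_ae hfφ)⟩

theorem dense_ae_eq_contDiff_of_mutuallySingular (hp : p ≠ ⊤) {μ ν : Measure V}
    [IsFiniteMeasureOnCompacts μ] [IsFiniteMeasureOnCompacts ν] (h : μ ⟂ₘ ν) :
    Dense {q : Lp F p μ × Lp F p ν | ∃ φ : V → F, ContDiff ℝ ∞ φ ∧ HasCompactSupport φ ∧
      q.1 =ᵐ[μ] φ ∧ q.2 =ᵐ[ν] φ} := by
  obtain ⟨B, hB, hμ, hν⟩ := h
  have restrict_compl : (μ + ν).restrict Bᶜ = μ := by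
    rw [Measure.restrict_add, Measure.restrict_eq_zero.2 hν, add_zero,
      Measure.restrict_eq_self_of_ae_mem (s := Bᶜ) (measure_eq_zero_iff_ae_notMem.1 hμ)]
  have restrict_self : (μ + ν).restrict Bᶜᶜ = ν := by
    rw [Measure.restrict_add, compl_compl, Measure.restrict_eq_zero.2 hμ, zero_add,
      Measure.restrict_eq_self_of_ae_mem (mem_ae_iff.2 hν)]
  have : IsFiniteMeasureOnCompacts (μ + ν) := ⟨fun K hK => by
    rw [Measure.add_apply]
    exact ENNReal.add_lt_top.2 ⟨hK.measure_lt_top, hK.measure_lt_top⟩⟩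
  have key := dense_ae_eq_contDiff_restrict_compl (F := F) hp (μ + ν) hB.compl
  rwa [restrict_compl, restrict_self] at key

end Density

section Hausdorff

variable {X Y : Type*} [EMetricSpace X] [MeasurableSpace X] [BorelSpace X]
  [EMetricSpace Y] [MeasurableSpace Y] [BorelSpace Y]

theorem euclideanHausdorffMeasure_image_le {K : ℝ≥0} {f : X → Y} {s : Set X}
    (hf : LipschitzOnWith K f s) (k : ℕ) : μHE[k] (f '' s) ≤ (K : ℝ≥0∞) ^ k * μHE[k] s := by
  simp only [Measure.euclideanHausdorffMeasure_def, Measure.smul_apply, mul_smul_comm]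
  gcongr
  simpa only [ENNReal.rpow_natCast] using hf.hausdorffMeasure_image_le (Nat.cast_nonneg k)

theorem euclideanHausdorffMeasure_preimage_le {K : ℝ≥0} {f : X → Y} (hf : AntilipschitzWith K f)
    (k : ℕ) (s : Set Y) : μHE[k] (f ⁻¹' s) ≤ (K : ℝ≥0∞) ^ k * μHE[k] s := by
  simp only [Measure.euclideanHausdorffMeasure_def, Measure.smul_apply, mul_smul_comm]
  gcongr
  simpa only [ENNReal.rpow_natCast] using hf.hausdorffMeasure_preimage_le (Nat.cast_nonneg k) s

theorem euclideanHausdorffMeasure_inter_preimage_le {K : ℝ≥0} {f : X → Y} {s : Set X}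
    (hf : AntilipschitzWith K (s.domRestrict f)) (k : ℕ) (t : Set Y) :
    μHE[k] (s ∩ f ⁻¹' t) ≤ (K : ℝ≥0∞) ^ k * μHE[k] t := by
  have himage : ((↑) : s → X) '' (s.domRestrict f ⁻¹' t) = s ∩ f ⁻¹' t :=
    Subtype.image_preimage_coe s (f ⁻¹' t)
  rw [← himage, isometry_subtype_coe.euclideanHausdorffMeasure_image]
  exact euclideanHausdorffMeasure_preimage_le hf k t

theorem euclideanHausdorffMeasure_finiteAt_nhdsWithin_range {k : ℕ}
    [IsLocallyFiniteMeasure (μHE[k] : Measure X)] {f : X → Y} {g : Y → X}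
    (hf : LocallyLipschitz f) (hg : Continuous g) (hgf : Function.LeftInverse g f) (y : Y) :
    (μHE[k] : Measure Y).FiniteAtFilter (𝓝[Set.range f] y) := by
  obtain ⟨K, s, hs, hK⟩ := hf (g y)
  obtain ⟨t, ht, hfinite⟩ := (μHE[k] : Measure X).finiteAt_nhds (g y)
  have hst : g ⁻¹' (s ∩ t) ∈ 𝓝 y := hg.continuousAt (inter_mem hs ht)
  have hsubset : Set.range f ∩ g ⁻¹' (s ∩ t) ⊆ f '' (s ∩ t) := by
    rintro _ ⟨⟨x, rfl⟩, hx⟩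
    exact ⟨x, by rwa [Set.mem_preimage, hgf x] at hx, rfl⟩
  refine ⟨_, inter_mem_nhdsWithin _ hst, ?_⟩
  calc μHE[k] (Set.range f ∩ g ⁻¹' (s ∩ t))
      ≤ μHE[k] (f '' (s ∩ t)) := measure_mono hsubset
    _ ≤ (K : ℝ≥0∞) ^ k * μHE[k] (s ∩ t) :=
      euclideanHausdorffMeasure_image_le (hK.mono Set.inter_subset_left) k
    _ ≤ (K : ℝ≥0∞) ^ k * μHE[k] t := by gcongr; exact Set.inter_subset_right
    _ < ⊤ := ENNReal.mul_lt_top (ENNReal.pow_lt_top ENNReal.coe_lt_top) hfinite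

end Hausdorff

section LocalParam

theorem exists_antilipschitzWith_domRestrict_of_injective {V F : Type*}
    [NormedAddCommGroup V] [NormedSpace ℝ V] [FiniteDimensional ℝ V]
    [NormedAddCommGroup F] [NormedSpace ℝ F] {f : V → F} {f' : V →L[ℝ] F} {x : V}
    (hf : HasStrictFDerivAt f f' x) (hinj : Function.Injective f') :
    ∃ s ∈ 𝓝 x, ∃ K : ℝ≥0, AntilipschitzWith K (s.domRestrict f) := by
  obtain ⟨K, hK, hf'⟩ := (f' : V →ₗ[ℝ] F).injective_iff_antilipschitz.1 hinj
  obtain ⟨c, hc, hcK⟩ := exists_between (inv_pos.2 hK)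
  obtain ⟨s, hs, happrox⟩ := hf.approximates_deriv_on_nhds (Or.inr hc)
  exact ⟨s, hs, _, (hf'.domRestrict s).add_sub_lipschitzWith (g := s.domRestrict f)
    happrox.lipschitz_sub hcK⟩

theorem euclideanHausdorffMeasure_inter_preimage_eq_zero {V F : Type*}
    [NormedAddCommGroup V] [NormedSpace ℝ V] [FiniteDimensional ℝ V] [MeasurableSpace V]
    [BorelSpace V] [NormedAddCommGroup F] [NormedSpace ℝ F] [MeasurableSpace F] [BorelSpace F]
    {W : Set V} (hW : IsOpen W) {ψ : V → F} (hψ : ContDiffOn ℝ 1 ψ W)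
    (hinj : ∀ y ∈ W, Function.Injective (fderiv ℝ ψ y)) {k : ℕ} {N : Set F}
    (hN : μHE[k] N = 0) : μHE[k] (W ∩ ψ ⁻¹' N) = 0 := by
  refine measure_null_of_locally_null _ fun y hy => ?_
  have hderiv : HasStrictFDerivAt ψ (fderiv ℝ ψ y) y :=
    (hψ.contDiffAt (hW.mem_nhds hy.1)).hasStrictFDerivAt one_ne_zero
  obtain ⟨s, hs, K, hK⟩ := exists_antilipschitzWith_domRestrict_of_injective hderiv (hinj y hy.1)
  refine ⟨s ∩ ψ ⁻¹' N, ?_, ?_⟩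
  · filter_upwards [mem_nhdsWithin_of_mem_nhds hs, self_mem_nhdsWithin] with z hzs hz
      using ⟨hzs, hz.2⟩
  · simpa only [hN, mul_zero, nonpos_iff_eq_zero] using
      euclideanHausdorffMeasure_inter_preimage_le hK k N

theorem IsLocalParam.comp_ae_eq {d : ℕ} {S : Set (E d)} {W : Set (E (d - 1))}
    {ψ : E (d - 1) → E d} (hψ : IsLocalParam S W ψ) (hS : MeasurableSet S) {f g : E d → ℝ}
    (h : f =ᵐ[(μHE[d - 1]).restrict S] g) : f ∘ ψ =ᵐ[volume.restrict W] g ∘ ψ := by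
  obtain ⟨hmaps, -⟩ := hψ.isOpenEmbedding
  have hnull : volume (W ∩ ψ ⁻¹' {x | ¬(x ∈ S → f x = g x)}) = 0 := by
    rw [← EuclideanSpace.euclideanHausdorffMeasure_eq_volume]
    exact euclideanHausdorffMeasure_inter_preimage_eq_zero hψ.isOpen
      (hψ.contDiffOn.of_le (by simp)) hψ.immersion ((ae_restrict_iff' hS).1 h)
  refine (ae_restrict_iff' hψ.isOpen.measurableSet).2 (measure_mono_null ?_ hnull)
  exact fun y hy => ⟨(Classical.not_imp.1 hy).1, fun hS => (Classical.not_imp.1 hy).2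
    (hS (hmaps (Classical.not_imp.1 hy).1))⟩

end LocalParam

section WeakDeriv

variable {k : ℕ} {U : Set (E k)} {i : Fin k} {f f' g : E k → ℝ}

theorem HasWeakPartialDeriv.congr_ae (h : HasWeakPartialDeriv U i f g)
    (hf : f' =ᵐ[volume.restrict U] f) : HasWeakPartialDeriv U i f' g := by
  intro η hη hηc hηU
  rw [← h η hη hηc hηU]
  exact integral_congr_ae (hf.mul (ae_eq_refl (partialDeriv i η)))

theorem MemH1.congr_ae (h : MemH1 U f) (hf : f' =ᵐ[volume.restrict U] f) : MemH1 U f' :=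
  ⟨(memLp_congr_ae hf).2 h.1, fun i =>
    let ⟨g, hg, hfg⟩ := h.2 i
    ⟨g, hg, hfg.congr_ae hf⟩⟩

theorem MemL2Loc.congr_ae (h : MemL2Loc U f) (hf : f' =ᵐ[volume.restrict U] f) :
    MemL2Loc U f' := fun K hK hKU =>
  (memLp_congr_ae (ae_restrict_of_ae_restrict_of_subset hKU hf)).2 (h K hK hKU)

theorem MemH1Loc.congr_ae (h : MemH1Loc U f) (hf : f' =ᵐ[volume.restrict U] f) :
    MemH1Loc U f' :=
  ⟨h.1.congr_ae hf, fun i =>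
    let ⟨g, hg, hfg⟩ := h.2 i
    ⟨g, hg, hfg.congr_ae hf⟩⟩

theorem continuousOn_partialDeriv (hU : IsOpen U) (hf : ContDiffOn ℝ 1 f U) (i : Fin k) :
    ContinuousOn (partialDeriv i f) U :=
  (hf.continuousOn_fderiv_of_isOpen hU le_rfl).clm_apply continuousOn_const

theorem integrable_mul_of_tsupport_subset {X : Type*} [TopologicalSpace X] [MeasurableSpace X]
    [OpensMeasurableSpace X] {μ : Measure X} [IsFiniteMeasureOnCompacts μ] {U : Set X}
    (hU : IsOpen U) {f η : X → ℝ} (hf : ContinuousOn f U) (hη : Continuous η)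
    (hηc : HasCompactSupport η) (hηU : tsupport η ⊆ U) : Integrable (fun x => f x * η x) μ := by
  have hcont : Continuous fun x => f x * η x :=
    (hf.mul hη.continuousOn).continuous_of_tsupport_subset hU
      ((closure_mono (Function.support_mul_subset_right f η)).trans hηU)
  exact hcont.integrable_of_hasCompactSupport hηc.mul_left

theorem hasWeakPartialDeriv_partialDeriv (hU : IsOpen U) (hf : ContDiffOn ℝ 1 f U) (i : Fin k) :
    HasWeakPartialDeriv U i f (partialDeriv i f) := by
  intro η hη hηc hηU
  have hDη : Continuous (partialDeriv i η) :=
    (hη.continuous_fderiv (by simp)).clm_apply continuous_const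
  have hDηc : HasCompactSupport (partialDeriv i η) := hηc.fderiv_apply ℝ _
  have hDηU : tsupport (partialDeriv i η) ⊆ U := (tsupport_fderiv_apply_subset ℝ _).trans hηU
  have setIntegral_mul_eq {a b : E k → ℝ} (hb : tsupport b ⊆ U) :
      ∫ x in U, a x * b x = ∫ x, a x * b x :=
    setIntegral_eq_integral_of_forall_compl_eq_zero fun x hx => by
      rw [image_eq_zero_of_notMem_tsupport fun h => hx (hb h), mul_zero]
  rw [setIntegral_mul_eq hDηU, setIntegral_mul_eq hηU]
  exact integral_mul_fderiv_eq_neg_fderiv_mul_of_integrable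
    (integrable_mul_of_tsupport_subset hU (continuousOn_partialDeriv hU hf i) hη.continuous
      hηc hηU)
    (integrable_mul_of_tsupport_subset hU hf.continuousOn hDη hDηc hDηU)
    (integrable_mul_of_tsupport_subset hU hf.continuousOn hη.continuous hηc hηU)
    (fun x hx => (hf.contDiffAt (hU.mem_nhds (hηU hx))).differentiableAt one_ne_zero)
    (fun x _ => hη.differentiable (by simp) x)

theorem memL2Loc_of_continuousOn (hf : ContinuousOn f U) : MemL2Loc U f := by
  intro K hK hKU
  have : IsFiniteMeasure (volume.restrict K) := isFiniteMeasure_restrict.2 hK.measure_ne_top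
  obtain ⟨C, hC⟩ := hK.exists_bound_of_continuousOn (hf.mono hKU)
  exact MemLp.of_bound ((hf.mono hKU).aestronglyMeasurable hK.measurableSet) C
    (ae_restrict_of_forall_mem hK.measurableSet hC)

theorem memH1Loc_of_contDiffOn (hU : IsOpen U) (hf : ContDiffOn ℝ 1 f U) : MemH1Loc U f :=
  ⟨memL2Loc_of_continuousOn hf.continuousOn, fun i => ⟨partialDeriv i f,
    memL2Loc_of_continuousOn (continuousOn_partialDeriv hU hf i),
    hasWeakPartialDeriv_partialDeriv hU hf i⟩⟩

theorem memLp_partialDeriv_of_hasCompactSupport (hf : ContDiff ℝ 1 f)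
    (hc : HasCompactSupport f) {p : ℝ≥0∞} (μ : Measure (E k)) [IsFiniteMeasureOnCompacts μ]
    (i : Fin k) : MemLp (partialDeriv i f) p μ :=
  ((hf.continuous_fderiv one_ne_zero).clm_apply continuous_const).memLp_of_hasCompactSupport
    (hc.fderiv_apply ℝ _)

end WeakDeriv

section Traces

variable {d : ℕ} {Ω : Set (E d)} {φ u u' g g' : E d → ℝ}

theorem MemH1Boundary.congr_ae (h : MemH1Boundary Ω g) (hg : g' =ᵐ[surfaceMeasure Ω] g) :
    MemH1Boundary Ω g' :=
  ⟨(memLp_congr_ae hg).2 h.1, fun W ψ hψ =>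
    (h.2 W ψ hψ).congr_ae (hψ.comp_ae_eq isClosed_frontier.measurableSet hg)⟩

theorem IsTrace.congr_ae (h : IsTrace Ω u g) (hu : u' =ᵐ[bulkMeasure Ω] u)
    (hg : g' =ᵐ[surfaceMeasure Ω] g) : IsTrace Ω u' g' := by
  obtain ⟨Du, hDu, φ, hφ, hφu, hφDu, hφg⟩ := h
  refine ⟨Du, fun i => ⟨(hDu i).1, (hDu i).2.congr_ae hu⟩, φ, hφ, ?_, hφDu, ?_⟩
  · exact hφu.congr fun n => eLpNorm_congr_ae ((ae_eq_refl (φ n)).sub hu.symm)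
  · exact hφg.congr fun n => eLpNorm_congr_ae ((ae_eq_refl (φ n)).sub hg.symm)

theorem memH1_of_contDiffOn (hΩ : IsOpen Ω) (hφ : ContDiffOn ℝ 1 φ Ω)
    (hL2 : MemLp φ 2 (bulkMeasure Ω)) (hDL2 : ∀ i, MemLp (partialDeriv i φ) 2 (bulkMeasure Ω)) :
    MemH1 Ω φ :=
  ⟨hL2, fun i => ⟨partialDeriv i φ, hDL2 i, hasWeakPartialDeriv_partialDeriv hΩ hφ i⟩⟩

theorem memH1Boundary_of_contDiff (hφ : ContDiff ℝ 1 φ) (hL2 : MemLp φ 2 (surfaceMeasure Ω)) :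
    MemH1Boundary Ω φ :=
  ⟨hL2, fun _W _ψ hψ => memH1Loc_of_contDiffOn hψ.isOpen
    (hφ.comp_contDiffOn (hψ.contDiffOn.of_le (by simp)))⟩

theorem isTrace_self_of_contDiff (hΩ : IsOpen Ω) (hφ : ContDiff ℝ ∞ φ)
    (hDL2 : ∀ i, MemLp (partialDeriv i φ) 2 (bulkMeasure Ω)) : IsTrace Ω φ φ :=
  ⟨fun i => partialDeriv i φ, fun i => ⟨hDL2 i,
    hasWeakPartialDeriv_partialDeriv hΩ (hφ.of_le (by simp)).contDiffOn i⟩,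
    fun _ => φ, fun _ => hφ, by simp, by simp, by simp⟩

theorem mem_VSpace_of_ae_eq_contDiff (hΩ : IsOpen Ω) (hφ : ContDiff ℝ ∞ φ)
    (hc : HasCompactSupport φ) {q : HSpace Ω} (hbulk : q.fst =ᵐ[bulkMeasure Ω] φ)
    (hsurface : q.snd =ᵐ[surfaceMeasure Ω] φ) : q ∈ VSpace Ω := by
  have hφ₁ : ContDiff ℝ 1 φ := hφ.of_le (by simp)
  have hDL2 (i : Fin d) : MemLp (partialDeriv i φ) 2 (bulkMeasure Ω) :=
    memLp_partialDeriv_of_hasCompactSupport hφ₁ hc (volume.restrict Ω) i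
  refine ⟨?_, ?_, (isTrace_self_of_contDiff hΩ hφ hDL2).congr_ae hbulk hsurface⟩
  · exact (memH1_of_contDiffOn hΩ hφ₁.contDiffOn ((memLp_congr_ae hbulk).1 (Lp.memLp q.fst))
      hDL2).congr_ae hbulk
  · exact (memH1Boundary_of_contDiff hφ₁ ((memLp_congr_ae hsurface).1
      (Lp.memLp q.snd))).congr_ae hsurface

end Traces

section SurfaceMeasure

theorem inter_frontier_subset_of_forall_mem_iff_lt {X α : Type*} [TopologicalSpace X]
    [TopologicalSpace α] [LinearOrder α] [OrderClosedTopology α] {s U : Set X} (hU : IsOpen U)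
    {a b : X → α} (ha : Continuous a) (hb : Continuous b) (h : ∀ y ∈ U, y ∈ s ↔ a y < b y) :
    U ∩ frontier s ⊆ {y | a y = b y} := by
  have hs : s ∩ U = {y | a y < b y} ∩ U := by
    ext y
    exact and_congr_left (h y)
  rw [Set.inter_comm, ← frontier_inter_open_inter hU, hs, frontier_inter_open_inter hU]
  exact Set.inter_subset_left.trans (frontier_lt_subset_eq ha hb)

theorem euclideanHausdorffMeasure_finiteAt_nhdsWithin_frontier {k : ℕ} {V : Type*}
    [NormedAddCommGroup V] [NormedSpace ℝ V] [MeasurableSpace V] [BorelSpace V] {s U : Set V}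
    {x : V} (hU : U ∈ 𝓝 x) (e : V ≃ₗᵢ[ℝ] WithLp 2 (E k × ℝ)) {γ : E k → ℝ}
    (hγ : LocallyLipschitz γ) (h : ∀ y ∈ U, y ∈ s ↔ γ (e y).fst < (e y).snd) :
    (μHE[k] : Measure V).FiniteAtFilter (𝓝[frontier s] x) := by
  have hfst : Continuous fun y => (e y).fst := by fun_prop
  have hsnd : Continuous fun y => (e y).snd := by fun_prop
  let graph : E k → V := fun z => e.symm (WithLp.toLp 2 (z, γ z))
  have graph_lipschitz : LocallyLipschitz graph :=
    e.symm.lipschitz.locallyLipschitz.comp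
      ((WithLp.prod_lipschitzWith_toLp 2 _ _).locallyLipschitz.comp
        (LocallyLipschitz.id.prodMk hγ))
  have graph_leftInverse : Function.LeftInverse (fun y => (e y).fst) graph := fun z => by
    simp [graph]
  have frontier_subset : interior U ∩ frontier s ⊆ Set.range graph := fun y hy => by
    have hy' : γ (e y).fst = (e y).snd :=
      inter_frontier_subset_of_forall_mem_iff_lt isOpen_interior (hγ.continuous.comp hfst) hsnd
        (fun z hz => h z (interior_subset hz)) hy
    refine ⟨(e y).fst, e.injective ?_⟩
    rw [e.apply_symm_apply, hy']
    rfl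
  have : IsLocallyFiniteMeasure (μHE[k] : Measure (E k)) := by
    rw [EuclideanSpace.euclideanHausdorffMeasure_eq_volume]
    infer_instance
  refine (euclideanHausdorffMeasure_finiteAt_nhdsWithin_range graph_lipschitz hfst
    graph_leftInverse x).filter_mono (nhdsWithin_le_iff.2 ?_)
  filter_upwards [self_mem_nhdsWithin, mem_nhdsWithin_of_mem_nhds (interior_mem_nhds.2 hU)]
    with y hys hyU using frontier_subset ⟨hyU, hys⟩

theorem isLocallyFiniteMeasure_restrict_of_isClosed {X : Type*} [TopologicalSpace X]
    [MeasurableSpace X] [OpensMeasurableSpace X] {μ : Measure X} {s : Set X} (hs : IsClosed s)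
    (h : ∀ x ∈ s, μ.FiniteAtFilter (𝓝[s] x)) : IsLocallyFiniteMeasure (μ.restrict s) := by
  constructor
  intro x
  have hx : μ.FiniteAtFilter (𝓝[s] x) := by
    by_cases hxs : x ∈ s
    · exact h x hxs
    · rw [notMem_closure_iff_nhdsWithin_eq_bot.1 (hs.closure_eq.symm ▸ hxs)]
      exact μ.finiteAtBot
  exact (hx.measure_mono Measure.restrict_le_self).filter_mono_ae
    (inf_le_inf_left _ (le_principal_iff.2 (ae_restrict_mem hs.measurableSet)))

theorem IsBoundedSmoothDomain.isLocallyFiniteMeasure_surfaceMeasure {d : ℕ} {Ω : Set (E d)}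
    (hΩ : IsBoundedSmoothDomain Ω) : IsLocallyFiniteMeasure (surfaceMeasure Ω) := by
  refine isLocallyFiniteMeasure_restrict_of_isClosed isClosed_frontier fun x hx => ?_
  obtain ⟨r, hr, e, γ, hγ, h⟩ := hΩ.smooth_boundary x hx
  exact euclideanHausdorffMeasure_finiteAt_nhdsWithin_frontier (Metric.ball_mem_nhds x hr) e
    (hγ.of_le (by simp)).locallyLipschitz h

theorem mutuallySingular_bulkMeasure_surfaceMeasure {d : ℕ} {Ω : Set (E d)} (hΩ : IsOpen Ω) :
    bulkMeasure Ω ⟂ₘ surfaceMeasure Ω := by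
  refine ⟨Ωᶜ, hΩ.measurableSet.compl, ?_, ?_⟩
  · rw [bulkMeasure, Measure.restrict_apply hΩ.measurableSet.compl, Set.compl_inter_self,
      measure_empty]
  · rw [compl_compl, surfaceMeasure, Measure.restrict_apply hΩ.measurableSet,
      hΩ.inter_frontier_eq, measure_empty]

end SurfaceMeasure

end DynBdry

open DynBdry in
theorem proposition5p1_general {d : ℕ} {Ω : Set (EuclideanSpace ℝ (Fin d))} (hΩ : IsOpen Ω)
    [IsLocallyFiniteMeasure (surfaceMeasure Ω)] : Dense (VSpace Ω) := by
  have : IsLocallyFiniteMeasure (bulkMeasure Ω) :=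
    inferInstanceAs (IsLocallyFiniteMeasure (volume.restrict Ω))
  refine ((dense_ae_eq_contDiff_of_mutuallySingular (p := 2) (F := ℝ) (by simp)
    (mutuallySingular_bulkMeasure_surfaceMeasure hΩ)).preimage
      (WithLp.homeomorphProd 2 _ _).isOpenMap).mono ?_
  rintro q ⟨φ, hφ, hc, hbulk, hsurface⟩
  exact mem_VSpace_of_ae_eq_contDiff hΩ hφ hc hbulk hsurface

theorem proposition5p1 (d : ℕ) (hd : 1 ≤ d) (Ω : Set (EuclideanSpace ℝ (Fin d)))
    (hΩ : DynBdry.IsBoundedSmoothDomain Ω) :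
    Dense (DynBdry.VSpace Ω) := by
  have := hΩ.isLocallyFiniteMeasure_surfaceMeasure
  exact proposition5p1_general hΩ.isOpen
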